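/- Let $N\ge 0$ and $K\ge 1$ be integers. Let $C(S^{N-1}_{\mathbb C,K})$ be the universal unital $C^*$-algebra generated by elements $z_1,\dots,z_N$ subject to the relations $$\sum_i z_iz_i^*=\sum_i z_i^*z_i=1,\qquad [z_{i_1}\cdots z_{i_K},\,z_{j_1}\cdots z_{j_K}]=0=[z_{i_1}\cdots z_{i_K},\,z_{j_1}^*\cdots z_{j_K}^*]$$ for all indices $i_1,\dots,i_K,j_1,\dots,j_K\in\{1,\dots,N\}$. The group $\mu_K$ of $K$-th roots of unity acts on it by $*$-automorphisms determined by $\omega\cdot z_i=\omega z_i$. This gives the $\mathbb Z_K$-grading with components $C(S^{N-1}_{\mathbb C,K})_j=\{a:\ \omega\cdot a=\omega^j a\ \ \forall\,\omega\in\mu_K\}$; in particular $C(S^{N-1}_{\mathbb C,K})_0$ is the $C^*$-subalgebra of all $\mu_K$-invariant elements. Let $\mathcal P_u((\mathbb C^N)^{\otimes K})$ be the compact space of pure tensors $v_1\otimes\cdots\otimes v_K$ (all $v_k\neq 0$) of norm $1$ in the Hilbert space $(\mathbb C^N)^{\otimes K}$, and let $r_{i_1\ldots i_K}$ be the continuous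 function on it that takes the coefficient of $e_{i_1}\otimes\cdots\otimes e_{i_K}$, where $e_1,\dots,e_N$ is the canonical basis of $\mathbb C^N$. Then there is a unique unital $*$-homomorphism $$\Phi:\ C(\mathcal P_u((\mathbb C^N)^{\otimes K}))\longrightarrow C(S^{N-1}_{\mathbb C,K})_0,\qquad r_{i_1\ldots i_K}\longmapsto z_{i_1}\cdots z_{i_K}\quad\text{for all } i_1,\dots,i_K,$$ and $\Phi$ is an isomorphism of $C^*$-algebras. -/

import Mathlib

open scoped ENNReal TensorProduct CStarAlgebra

noncomputable section

namespace HalfLiberated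

/-! ### The defining relations -/

/-- The monomial `z_{i_1} z_{i_2} ⋯ z_{i_K}`, the product being taken in this order. -/
def word {N K : ℕ} {B : Type*} [Monoid B] (z : Fin N → B) (i : Fin K → Fin N) : B :=
  (List.ofFn fun k => z (i k)).prod

/-- The defining relations of the `K`-half-liberated complex sphere, for an `N`-tuple `z` in a
unital `*`-ring: the two free sphere relations, and the relations
`[z_{i_1} ⋯ z_{i_K}, z_{j_1} ⋯ z_{j_K}] = 0 = [z_{i_1} ⋯ z_{i_K}, z_{j_1}^* ⋯ z_{j_K}^*]`. -/
structure IsHalfLiberated {N : ℕ} (K : ℕ) {B : Type*} [Ring B] [StarRing B]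
    (z : Fin N → B) : Prop where
  sum_mul_star : ∑ i, z i * star (z i) = 1
  sum_star_mul : ∑ i, star (z i) * z i = 1
  comm : ∀ i j : Fin K → Fin N, Commute (word z i) (word z j)
  comm_star : ∀ i j : Fin K → Fin N, Commute (word z i) (word (fun n => star (z n)) j)

theorem map_word {N K : ℕ} {B C F : Type*} [Monoid B] [Monoid C] [FunLike F B C]
    [MonoidHomClass F B C] (f : F) (z : Fin N → B) (i : Fin K → Fin N) :
    f (word z i) = word (fun n => f (z n)) i := by
  simp [word, map_list_prod, List.map_ofFn, Function.comp_def]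

theorem word_smul {N K : ℕ} {B : Type*} [Ring B] [Algebra ℂ B] (c : ℂ) (z : Fin N → B)
    (i : Fin K → Fin N) : word (fun n => c • z n) i = c ^ K • word z i := by
  induction K with
  | zero => simp [word]
  | succ K ih =>
    have h := ih (fun k => i k.succ)
    simp only [word, List.ofFn_succ, List.prod_cons] at h ⊢
    rw [h, smul_mul_smul_comm, pow_succ']

theorem IsHalfLiberated.map {N K : ℕ} {B C : Type*} [Ring B] [StarRing B] [Algebra ℂ B]
    [Ring C] [StarRing C] [Algebra ℂ C] {z : Fin N → B} (h : IsHalfLiberated K z)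
    (f : B →⋆ₐ[ℂ] C) : IsHalfLiberated K (fun n => f (z n)) where
  sum_mul_star := by simpa [map_star] using congrArg f h.sum_mul_star
  sum_star_mul := by simpa [map_star] using congrArg f h.sum_star_mul
  comm i j := by simpa only [map_word] using (h.comm i j).map f
  comm_star i j := by simpa only [map_word, map_star] using (h.comm_star i j).map f

theorem IsHalfLiberated.of_map {N K : ℕ} {B C : Type*} [Ring B] [StarRing B] [Algebra ℂ B]
    [Ring C] [StarRing C] [Algebra ℂ C] {z : Fin N → B} (f : B →⋆ₐ[ℂ] C)
    (hf : Function.Injective f) (h : IsHalfLiberated K (fun n => f (z n))) :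
    IsHalfLiberated K z where
  sum_mul_star := hf (by simpa [map_star] using h.sum_mul_star)
  sum_star_mul := hf (by simpa [map_star] using h.sum_star_mul)
  comm i j := hf (by simpa only [map_word, map_mul] using (h.comm i j).eq)
  comm_star i j := hf (by simpa only [map_word, map_mul, map_star] using (h.comm_star i j).eq)

theorem IsHalfLiberated.smul {N K : ℕ} {B : Type*} [Ring B] [StarRing B] [Algebra ℂ B]
    [StarModule ℂ B] {z : Fin N → B} (h : IsHalfLiberated K z) {c : ℂ} (hc : c * star c = 1) :
    IsHalfLiberated K (fun n => c • z n) where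
  sum_mul_star := by
    simp only [star_smul, smul_mul_smul_comm, hc, one_smul, h.sum_mul_star]
  sum_star_mul := by
    simp only [star_smul, smul_mul_smul_comm, mul_comm (star c), hc, one_smul, h.sum_star_mul]
  comm i j := by
    simp only [word_smul]
    exact ((h.comm i j).smul_left _).smul_right _
  comm_star i j := by
    simp only [star_smul, word_smul]
    exact ((h.comm_star i j).smul_left _).smul_right _

theorem IsHalfLiberated.norm_le_one {N K : ℕ} {B : Type*} [CStarAlgebra B] {z : Fin N → B}
    (h : IsHalfLiberated K z) (n : Fin N) : ‖z n‖ ≤ 1 := by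
  let _ := CStarAlgebra.spectralOrder B
  have := CStarAlgebra.spectralOrderedRing B
  nontriviality B
  have h1 : star (z n) * z n ≤ 1 := by
    rw [← h.sum_star_mul]
    exact Finset.single_le_sum (f := fun i => star (z i) * z i)
      (fun i _ => star_mul_self_nonneg (z i)) (Finset.mem_univ n)
  have h2 := CStarAlgebra.norm_le_norm_of_nonneg_of_le (star_mul_self_nonneg (z n)) h1
  rw [CStarRing.norm_star_mul_self, norm_one] at h2
  nlinarith [norm_nonneg (z n)]

/-! ### The universal `C^*`-algebra `C(S^{N-1}_{ℂ,K})` -/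

/-- A model of the relations: a nonzero unital `C^*`-algebra with a tuple satisfying them. -/
structure Model (N K : ℕ) : Type 1 where
  carrier : Type
  [cstar : CStarAlgebra carrier]
  [nontriv : Nontrivial carrier]
  coord : Fin N → carrier
  rel : IsHalfLiberated K coord

attribute [instance] Model.cstar Model.nontriv

/-- The `C^*`-algebra of bounded families indexed by all models. -/
abbrev Ambient (N K : ℕ) : Type 1 := lp (fun M : Model N K => M.carrier) ∞

instance (N K : ℕ) : CStarAlgebra (Ambient N K) where

/-- The universal tuple `z_n = (M.coord n)_M`. -/
def ambientCoord {N K : ℕ} (n : Fin N) : Ambient N K :=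
  ⟨fun M => M.coord n, memℓp_infty ⟨1, by rintro _ ⟨M, rfl⟩; exact M.rel.norm_le_one n⟩⟩

/-- The `*`-homomorphism evaluating a bounded family at a model. -/
def ambientEval {N K : ℕ} (M : Model N K) : Ambient N K →⋆ₐ[ℂ] M.carrier where
  toFun f := f M
  map_one' := rfl
  map_mul' _ _ := rfl
  map_zero' := rfl
  map_add' _ _ := rfl
  commutes' _ := rfl
  map_star' _ := rfl

theorem ambientEval_coord {N K : ℕ} (M : Model N K) (n : Fin N) :
    ambientEval M (ambientCoord n) = M.coord n := rfl

theorem ambient_ext {N K : ℕ} {f g : Ambient N K}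
    (h : ∀ M : Model N K, ambientEval M f = ambientEval M g) : f = g :=
  lp.ext (funext h)

theorem ambientCoord_rel (N K : ℕ) :
    IsHalfLiberated K (ambientCoord : Fin N → Ambient N K) where
  sum_mul_star := ambient_ext fun M => by
    simpa [map_star, ambientEval_coord] using M.rel.sum_mul_star
  sum_star_mul := ambient_ext fun M => by
    simpa [map_star, ambientEval_coord] using M.rel.sum_star_mul
  comm i j := ambient_ext fun M => by
    simpa only [map_mul, map_word, ambientEval_coord] using (M.rel.comm i j).eq
  comm_star i j := ambient_ext fun M => by
    simpa only [map_mul, map_word, map_star, ambientEval_coord] using (M.rel.comm_star i j).eq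

/-- `C(S^{N-1}_{ℂ,K})`, the universal unital `C^*`-algebra generated by `z_1, …, z_N` subject to
the relations `IsHalfLiberated K z`, built as the `C^*`-algebra generated by the universal tuple.
Its universal property, with respect to `C^*`-algebras in all universes, is proved below
(`coord_rel`, `lift`, `lift_coord`, `hom_ext`). -/
abbrev sphere (N K : ℕ) : StarSubalgebra ℂ (Ambient N K) :=
  (StarAlgebra.adjoin ℂ (Set.range (ambientCoord : Fin N → Ambient N K))).topologicalClosure

instance (N K : ℕ) : IsClosed (sphere N K : Set (Ambient N K)) :=
  StarSubalgebra.isClosed_topologicalClosure _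

/-- The coordinates `z_n ∈ C(S^{N-1}_{ℂ,K})`. -/
def coord {N K : ℕ} (n : Fin N) : sphere N K :=
  ⟨ambientCoord n, StarSubalgebra.le_topologicalClosure _
    (StarAlgebra.subset_adjoin ℂ _ ⟨n, rfl⟩)⟩

theorem coord_rel (N K : ℕ) : IsHalfLiberated K (coord : Fin N → sphere N K) :=
  IsHalfLiberated.of_map (sphere N K).subtype Subtype.val_injective (ambientCoord_rel N K)

/-- `*`-homomorphisms out of `C(S^{N-1}_{ℂ,K})` are determined by their values on coordinates. -/
theorem hom_ext {N K : ℕ} {B : Type*} [CStarAlgebra B] {f g : sphere N K →⋆ₐ[ℂ] B}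
    (h : ∀ n, f (coord n) = g (coord n)) : f = g := by
  have hf : Continuous f := map_continuous f
  have hg : Continuous g := map_continuous g
  refine StarAlgHomClass.ext_topologicalClosure hf hg ?_
  intro x
  refine StarAlgebra.adjoin_induction_subtype x ?_ ?_ ?_ ?_ ?_
  · rintro _ ⟨n, rfl⟩
    exact h n
  · intro r
    exact (f.commutes r).trans (g.commutes r).symm
  · intro x y hx hy
    rw [map_add, map_add, map_add, hx, hy]
  · intro x y hx hy
    rw [map_mul, map_mul, map_mul, hx, hy]
  · intro x hx
    rw [map_star, map_star, map_star, hx]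

/-- Every finitely generated `C^*`-algebra has a copy in the lowest universe. -/
theorem small_closure {N : ℕ} {B : Type*} [CStarAlgebra B] (z : Fin N → B) :
    Small.{0} (StarAlgebra.adjoin ℂ (Set.range z)).topologicalClosure := by
  set g : Fin N ⊕ Fin N → B := Sum.elim z (fun n => star (z n))
  let F : (ℕ → FreeAlgebra ℂ (Fin N ⊕ Fin N)) → B :=
    fun s => Filter.limUnder Filter.atTop fun n => FreeAlgebra.lift ℂ g (s n)
  have hsub : ((StarAlgebra.adjoin ℂ (Set.range z)).topologicalClosure : Set B) ⊆ Set.range F := by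
    intro x hx
    obtain ⟨u, hu, hx⟩ := mem_closure_iff_seq_limit.1 hx
    have hr : ∀ n, ∃ p, FreeAlgebra.lift ℂ g p = u n := by
      intro n
      have h1 : u n ∈ Algebra.adjoin ℂ (Set.range z ∪ star (Set.range z)) := hu n
      have h2 : Set.range z ∪ star (Set.range z) = Set.range g := by
        ext b
        have h3 : ∀ y, z y = star b ↔ b = star (z y) := fun y =>
          ⟨fun h => by rw [h, star_star], fun h => by rw [h, star_star]⟩
        simp only [g, Set.Sum.elim_range, Set.mem_union, Set.mem_star, Set.mem_range, h3,
          eq_comm (b := b)]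
      rw [h2, Algebra.adjoin_range_eq_range_freeAlgebra_lift] at h1
      exact h1
    choose s hs using hr
    refine ⟨s, ?_⟩
    have : (fun n => FreeAlgebra.lift ℂ g (s n)) = u := funext hs
    simp only [F, this]
    exact hx.limUnder_eq
  exact small_subset hsub

/-- A small `C^*`-algebra is isomorphic to one in the lowest universe. -/
theorem exists_copy {S : Type*} [CStarAlgebra S] [Small.{0} S] :
    ∃ (T : Type) (_ : CStarAlgebra T), Nonempty (T ≃⋆ₐ[ℂ] S) := by
  let e : Shrink.{0} S ≃ₐ[ℂ] S := Shrink.algEquiv ℂ S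
  let nr : NormedRing (Shrink.{0} S) :=
    NormedRing.induced (Shrink.{0} S) S e.toRingEquiv.toRingHom e.injective
  let : NormedAlgebra ℂ (Shrink.{0} S) :=
    { norm_smul_le := fun a b => by
        change ‖e (a • b)‖ ≤ ‖a‖ * ‖e b‖
        rw [map_smul]
        exact norm_smul_le a (e b) }
  let sr : StarRing (Shrink.{0} S) :=
    { star := fun x => e.symm (star (e x))
      star_involutive := fun x => by
        change e.symm (star (e (e.symm (star (e x))))) = x
        simp
      star_mul := fun x y => by
        change e.symm (star (e (x * y))) = e.symm (star (e y)) * e.symm (star (e x))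
        simp
      star_add := fun x y => by
        change e.symm (star (e (x + y))) = e.symm (star (e x)) + e.symm (star (e y))
        simp }
  have hstar : ∀ x : Shrink.{0} S, e (star x) = star (e x) := fun x =>
    e.apply_symm_apply _
  have hiso : Isometry e := AddMonoidHomClass.isometry_of_norm e fun x => rfl
  let : CStarAlgebra (Shrink.{0} S) :=
    { complete := (hiso.isUniformInducing.completeSpace_congr e.surjective).2
        inferInstance |>.complete
      norm_mul_self_le := fun x => by
        change ‖e x‖ * ‖e x‖ ≤ ‖e (star x * x)‖
        rw [map_mul, hstar, CStarRing.norm_star_mul_self]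
      star_smul := fun r x => e.injective (by
        rw [hstar, map_smul, star_smul, map_smul, hstar]) }
  exact ⟨Shrink.{0} S, this, ⟨StarAlgEquiv.ofAlgEquiv e hstar⟩⟩

/-- The universal property of `C(S^{N-1}_{ℂ,K})`, existence part. -/
theorem exists_lift {N K : ℕ} {B : Type*} [CStarAlgebra B] {b : Fin N → B}
    (hb : IsHalfLiberated K b) : ∃ f : sphere N K →⋆ₐ[ℂ] B, ∀ n, f (coord n) = b n := by
  rcases subsingleton_or_nontrivial B with hB | hB
  · exact ⟨{ toFun := fun _ => 0
             map_one' := Subsingleton.elim _ _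
             map_mul' := fun _ _ => Subsingleton.elim _ _
             map_zero' := rfl
             map_add' := fun _ _ => Subsingleton.elim _ _
             commutes' := fun _ => Subsingleton.elim _ _
             map_star' := fun _ => Subsingleton.elim _ _ }, fun _ => Subsingleton.elim _ _⟩
  · set S : StarSubalgebra ℂ B := (StarAlgebra.adjoin ℂ (Set.range b)).topologicalClosure with hS
    have hcl : IsClosed (S : Set B) := StarSubalgebra.isClosed_topologicalClosure _
    have hsm : Small.{0} S := small_closure b
    obtain ⟨T, hT, ⟨e⟩⟩ := exists_copy (S := S)
    let c : Fin N → T := fun n => e.symm ⟨b n, StarSubalgebra.le_topologicalClosure _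
      (StarAlgebra.subset_adjoin ℂ _ ⟨n, rfl⟩)⟩
    let φ : T →⋆ₐ[ℂ] B := S.subtype.comp (e : T →⋆ₐ[ℂ] S)
    have hφ : Function.Injective φ := Subtype.val_injective.comp e.injective
    have hφc : ∀ n, φ (c n) = b n := fun n => congrArg Subtype.val (e.apply_symm_apply _)
    have hc : IsHalfLiberated K c :=
      IsHalfLiberated.of_map φ hφ (by simpa only [hφc] using hb)
    have : Nontrivial T := e.toEquiv.nontrivial
    let M : Model N K := { carrier := T, coord := c, rel := hc }
    exact ⟨φ.comp ((ambientEval M).comp (sphere N K).subtype), fun n => hφc n⟩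

/-- The `*`-homomorphism `C(S^{N-1}_{ℂ,K}) → B` with `z_n ↦ b_n`, for a tuple `b` satisfying the
defining relations. -/
def lift {N K : ℕ} {B : Type*} [CStarAlgebra B] (b : Fin N → B) (hb : IsHalfLiberated K b) :
    sphere N K →⋆ₐ[ℂ] B :=
  (exists_lift hb).choose

theorem lift_coord {N K : ℕ} {B : Type*} [CStarAlgebra B] (b : Fin N → B)
    (hb : IsHalfLiberated K b) (n : Fin N) : lift b hb (coord n) = b n :=
  (exists_lift hb).choose_spec n

/-! ### The `ℤ_K`-grading -/

/-- The `*`-endomorphism `a ↦ ω · a` of `C(S^{N-1}_{ℂ,K})` with `ω · z_n = ω z_n`. -/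
def rotation {N K : ℕ} (ω : Circle) : sphere N K →⋆ₐ[ℂ] sphere N K :=
  lift (fun n => (ω : ℂ) • coord n) ((coord_rel N K).smul (by
    rw [Complex.star_def, Complex.mul_conj, Complex.normSq_eq_norm_sq, Circle.norm_coe]; simp))

/-- The degree `j` component for the action of the group `μ_K` of `K`-th roots of unity:
all `a` with `ω · a = ω ^ j a` for every `ω ∈ μ_K`. -/
def component (N K : ℕ) (j : ZMod K) : Submodule ℂ (sphere N K) where
  carrier := {a | ∀ ω : Circle, ω ^ K = 1 → rotation ω a = (ω : ℂ) ^ j.val • a}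
  zero_mem' ω _ := by simp
  add_mem' ha hb ω hω := by rw [map_add, ha ω hω, hb ω hω, smul_add]
  smul_mem' c a ha ω hω := by rw [map_smul, ha ω hω, smul_comm]

theorem mem_component_zero {N K : ℕ} {a : sphere N K} :
    a ∈ component N K 0 ↔ ∀ ω : Circle, ω ^ K = 1 → rotation ω a = a := by
  change (∀ ω : Circle, ω ^ K = 1 → rotation ω a = (ω : ℂ) ^ (0 : ZMod K).val • a) ↔ _
  simp

/-- `C(S^{N-1}_{ℂ,K})_0`, the degree `0` component, which is a `C^*`-subalgebra. -/
def degreeZero (N K : ℕ) : StarSubalgebra ℂ (sphere N K) where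
  carrier := component N K 0
  zero_mem' := zero_mem _
  add_mem' := add_mem
  one_mem' := mem_component_zero.2 fun ω _ => map_one _
  mul_mem' ha hb := mem_component_zero.2 fun ω hω => by
    rw [map_mul, mem_component_zero.1 ha ω hω, mem_component_zero.1 hb ω hω]
  algebraMap_mem' c := mem_component_zero.2 fun ω _ => AlgHomClass.commutes _ c
  star_mem' ha := mem_component_zero.2 fun ω hω => by
    rw [map_star, mem_component_zero.1 ha ω hω]

instance (N K : ℕ) : IsClosed (degreeZero N K : Set (sphere N K)) := by
  have h : (degreeZero N K : Set (sphere N K)) =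
      ⋂ ω : Circle, ⋂ _ : ω ^ K = 1, {a | rotation ω a = a} := by
    ext a
    simp only [Set.mem_iInter, Set.mem_ofPred_eq]
    exact mem_component_zero
  rw [h]
  exact isClosed_iInter fun ω => isClosed_iInter fun _ =>
    isClosed_eq (map_continuous (rotation ω)) continuous_id

/-! ### Pure tensors of norm one -/

/-- The tensor `∑ r_{i_1 … i_K} e_{i_1} ⊗ ⋯ ⊗ e_{i_K}` in `(ℂ^N)^{⊗K}` with coordinates `r`. -/
def tensorOf {N K : ℕ} (r : EuclideanSpace ℂ (Fin K → Fin N)) :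
    ⨂[ℂ] _ : Fin K, EuclideanSpace ℂ (Fin N) :=
  ∑ i : Fin K → Fin N, r i • ⨂ₜ[ℂ] k, EuclideanSpace.single (i k) (1 : ℂ)

/-- `P_u((ℂ^N)^{⊗K})`, the space of pure tensors of norm `1`. Tensors are given by their coordinates
in the basis `e_{i_1} ⊗ ⋯ ⊗ e_{i_K}`, which is orthonormal for the Hilbert space structure of
`(ℂ^N)^{⊗K}`, so that norm and topology are those of `EuclideanSpace ℂ (Fin K → Fin N)`. -/
def pureUnit (N K : ℕ) : Set (EuclideanSpace ℂ (Fin K → Fin N)) :=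
  {r | ‖r‖ = 1 ∧ ∃ v : Fin K → EuclideanSpace ℂ (Fin N),
    (∀ k, v k ≠ 0) ∧ tensorOf r = ⨂ₜ[ℂ] k, v k}

theorem tensorOf_eq_tprod_iff {N K : ℕ} (r : EuclideanSpace ℂ (Fin K → Fin N))
    (v : Fin K → EuclideanSpace ℂ (Fin N)) :
    tensorOf r = (⨂ₜ[ℂ] k, v k) ↔ ∀ i, r i = ∏ k, v k (i k) := by
  let b := Basis.piTensorProduct (R := ℂ)
    fun _ : Fin K => (EuclideanSpace.basisFun (Fin N) ℂ).toBasis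
  have hb : ∀ i, b i = ⨂ₜ[ℂ] k, EuclideanSpace.single (i k) (1 : ℂ) := by
    intro i
    simp [b]
  have h1 : ∀ i, b.repr (tensorOf r) i = r i := by
    intro i
    have : tensorOf r = ∑ i, r i • b i := by simp only [tensorOf, hb]
    rw [this, b.repr_sum_self]
  have h2 : ∀ i, b.repr (⨂ₜ[ℂ] k, v k) i = ∏ k, v k (i k) := by
    intro i
    simp [b]
  constructor
  · intro h i
    rw [← h1, h, h2]
  · intro h
    refine b.repr.injective (Finsupp.ext fun i => ?_)
    rw [h1, h2, h]

/-- The coordinates of `v_1 ⊗ ⋯ ⊗ v_K`. -/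
def pureCoords {N K : ℕ} (v : Fin K → EuclideanSpace ℂ (Fin N)) :
    EuclideanSpace ℂ (Fin K → Fin N) :=
  WithLp.toLp 2 fun i => ∏ k, v k (i k)

theorem norm_pureCoords {N K : ℕ} (v : Fin K → EuclideanSpace ℂ (Fin N)) :
    ‖pureCoords v‖ = ∏ k, ‖v k‖ := by
  have h : ‖pureCoords v‖ ^ 2 = (∏ k, ‖v k‖) ^ 2 := by
    rw [EuclideanSpace.norm_sq_eq, ← Finset.prod_pow]
    simp only [EuclideanSpace.norm_sq_eq]
    rw [Finset.prod_univ_sum, Fintype.piFinset_univ]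
    refine Finset.sum_congr rfl fun i _ => ?_
    rw [pureCoords, norm_prod, Finset.prod_pow]
  exact (pow_left_inj₀ (norm_nonneg _) (Finset.prod_nonneg fun _ _ => norm_nonneg _)
    two_ne_zero).1 h

theorem pureUnit_eq_image (N K : ℕ) : pureUnit N K =
    pureCoords '' (Set.univ.pi fun _ : Fin K => Metric.sphere (0 : EuclideanSpace ℂ (Fin N)) 1) := by
  ext r
  constructor
  · rintro ⟨hr, v, hv, h⟩
    rw [tensorOf_eq_tprod_iff] at h
    have hrv : r = pureCoords v := by
      ext i
      exact h i
    have hprod : ∏ k, ‖v k‖ = 1 := by rw [← norm_pureCoords, ← hrv, hr]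
    refine ⟨fun k => ((‖v k‖⁻¹ : ℝ) : ℂ) • v k, fun k _ => ?_, ?_⟩
    · rw [mem_sphere_zero_iff_norm, norm_smul, Complex.norm_real, norm_inv, norm_norm,
        inv_mul_cancel₀ (norm_ne_zero_iff.2 (hv k))]
    · rw [hrv]
      ext i
      simp only [pureCoords, PiLp.smul_apply, smul_eq_mul, Finset.prod_mul_distrib]
      rw [← Complex.ofReal_prod, Finset.prod_inv_distrib, hprod]
      simp
  · rintro ⟨v, hv, rfl⟩
    have hv1 : ∀ k, ‖v k‖ = 1 := fun k => mem_sphere_zero_iff_norm.1 (hv k trivial)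
    refine ⟨by simp [norm_pureCoords, hv1], v, fun k h0 => ?_,
      (tensorOf_eq_tprod_iff _ _).2 fun i => rfl⟩
    have := hv1 k
    simp [h0] at this

instance (N K : ℕ) : CompactSpace (pureUnit N K) := by
  rw [← isCompact_iff_compactSpace, pureUnit_eq_image]
  refine (isCompact_univ_pi fun _ => isCompact_sphere _ _).image ?_
  unfold pureCoords
  fun_prop

/-- The coordinate function `r_{i_1 … i_K} ∈ C(P_u((ℂ^N)^{⊗K}))`. -/
def coordFun {N K : ℕ} (i : Fin K → Fin N) : C(pureUnit N K, ℂ) where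
  toFun r := (r : EuclideanSpace ℂ (Fin K → Fin N)) i
  continuous_toFun := by fun_prop

end HalfLiberated

end

/-! Let `D` be the degree zero component. The plan is to show that `D` is commutative and to compute
its spectrum.

The sphere relations make the sums of `w w^*` and of `w^* w` over all words `w` of a fixed length
equal to `1`. Inserting such sums pads short products to length `K`. Hence every element of the
`*`-algebra generated by the `z_n` is a combination of products of a monomial in the `z_n` with an
element of `wordAlgebra` (`adjoin_le_monomialSpan`). Averaging over `μ_K` kills the monomials whose
length is not divisible by `K`, so `D` is the closure of `wordAlgebra`
(`degreeZero_subset_closure`). The words of length `K` commute with each other and with each other's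
adjoints, so `D` is commutative, and Gelfand duality identifies it with the functions on its
characters.

A character is determined by its values `r_i` on words. Padding also gives `z_a m z_b = z_b m z_a`
for monomials `m` of length `K - 1` (`swap`). The `r_i` therefore satisfy the Segre equations, which
characterize pure tensors among nonzero ones, and the sphere relations give norm `1`
(`char_mem_pureUnit`). Conversely, unit vectors `v_k` define a representation by cyclic weighted
shifts of size `K`; there `D` acts diagonally, and a diagonal entry is a character with values the
coordinates of the tensor product of the `v_k` (`exists_char_of_mem_pureUnit`). The spectrum of `D`
is thus the space of pure tensors of norm `1`. -/

noncomputable section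

namespace HalfLiberated

/-! ### Monomials in the generators -/

section Monomials

variable {N K : ℕ} {B : Type*}

/-- The product of the generators `z_n` along a list of indices. -/
def monomial [Monoid B] (z : Fin N → B) (l : List (Fin N)) : B := (l.map z).prod

@[simp] theorem monomial_nil [Monoid B] (z : Fin N → B) : monomial z [] = 1 := rfl

@[simp] theorem monomial_cons [Monoid B] (z : Fin N → B) (a : Fin N) (l : List (Fin N)) :
    monomial z (a :: l) = z a * monomial z l := by simp [monomial]

@[simp] theorem monomial_append [Monoid B] (z : Fin N → B) (l l' : List (Fin N)) :
    monomial z (l ++ l') = monomial z l * monomial z l' := by simp [monomial]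

theorem word_eq_monomial [Monoid B] (z : Fin N → B) (i : Fin K → Fin N) :
    word z i = monomial z (List.ofFn i) := by
  simp [word, monomial, List.map_ofFn, Function.comp_def]

theorem exists_word_eq_monomial [Monoid B] (z : Fin N → B) {l : List (Fin N)}
    (hl : l.length = K) : ∃ i : Fin K → Fin N, word z i = monomial z l := by
  subst hl
  exact ⟨l.get, by rw [word_eq_monomial, List.ofFn_get]⟩

theorem star_monomial [Monoid B] [StarMul B] (z : Fin N → B) (l : List (Fin N)) :
    star (monomial z l) = monomial (fun n => star (z n)) l.reverse := by
  induction l with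
  | nil => simp
  | cons a l ih => simp [ih]

variable [Ring B] [StarRing B] {z : Fin N → B}

theorem IsHalfLiberated.monomial_comm (h : IsHalfLiberated K z) {l l' : List (Fin N)}
    (hl : l.length = K) (hl' : l'.length = K) : Commute (monomial z l) (monomial z l') := by
  obtain ⟨i, hi⟩ := exists_word_eq_monomial z hl
  obtain ⟨j, hj⟩ := exists_word_eq_monomial z hl'
  rw [← hi, ← hj]
  exact h.comm i j

/-- The adjoint reverses the letters, whereas the starred words in the relations are not reversed.
This is harmless because the relations range over all words. -/
theorem IsHalfLiberated.monomial_comm_star (h : IsHalfLiberated K z) {l l' : List (Fin N)}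
    (hl : l.length = K) (hl' : l'.length = K) :
    Commute (monomial z l) (star (monomial z l')) := by
  obtain ⟨i, hi⟩ := exists_word_eq_monomial z hl
  obtain ⟨j, hj⟩ := exists_word_eq_monomial (fun n => star (z n))
    ((List.length_reverse (as := l')).trans hl')
  rw [← hi, star_monomial, ← hj]
  exact h.comm_star i j

/-- The sum over the tail of the word sits innermost and collapses to `1` by induction, leaving the
relation for the first letter. -/
theorem sum_word_mul_star (h : ∑ i, z i * star (z i) = 1) (m : ℕ) :
    ∑ y : Fin m → Fin N, word z y * star (word z y) = 1 := by
  induction m with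
  | zero => simp [word]
  | succ m ih =>
    rw [← (Fin.consEquiv fun _ => Fin N).sum_comp, Fintype.sum_prod_type, ← h]
    refine Finset.sum_congr rfl fun a _ => ?_
    have : ∀ y : Fin m → Fin N, word z (Fin.consEquiv (fun _ => Fin N) (a, y)) =
        z a * word z y := fun y => by simp [word]
    simp only [this, star_mul]
    simp only [mul_assoc, ← Finset.mul_sum]
    simp only [← mul_assoc (word z _), ← Finset.sum_mul, ih, one_mul]

/-- Here the first letter sits innermost, so it is summed before the tail. -/
theorem sum_star_mul_word (h : ∑ i, star (z i) * z i = 1) (m : ℕ) :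
    ∑ y : Fin m → Fin N, star (word z y) * word z y = 1 := by
  induction m with
  | zero => simp [word]
  | succ m ih =>
    rw [← (Fin.consEquiv fun _ => Fin N).sum_comp, Fintype.sum_prod_type_right, ← ih]
    refine Finset.sum_congr rfl fun y _ => ?_
    have : ∀ a : Fin N, word z (Fin.consEquiv (fun _ => Fin N) (a, y)) =
        z a * word z y := fun a => by simp [word]
    simp only [this, star_mul]
    simp only [mul_assoc, ← Finset.mul_sum]
    simp only [← mul_assoc (star (z _)), ← Finset.sum_mul, h, one_mul]

theorem sum_word_mul_star_mul (h : ∑ i, z i * star (z i) = 1) (m : ℕ) (b : B) :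
    ∑ y : Fin m → Fin N, word z y * (star (word z y) * b) = b := by
  simp only [← mul_assoc, ← Finset.sum_mul, sum_word_mul_star h, one_mul]

theorem sum_star_mul_word_mul (h : ∑ i, star (z i) * z i = 1) (m : ℕ) (b : B) :
    ∑ y : Fin m → Fin N, star (word z y) * (word z y * b) = b := by
  simp only [← mul_assoc, ← Finset.sum_mul, sum_star_mul_word h, one_mul]

/-! ### The commutative `*`-algebra generated by the words of length `K` -/

variable [Algebra ℂ B] [StarModule ℂ B]

/-- The `*`-algebra generated by the monomials of length `K`. -/
abbrev wordAlgebra (K : ℕ) (z : Fin N → B) : StarSubalgebra ℂ B :=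
  StarAlgebra.adjoin ℂ (Set.range fun i : Fin K → Fin N => word z i)

theorem monomial_mem_wordAlgebra {l : List (Fin N)} (hl : l.length = K) :
    monomial z l ∈ wordAlgebra K z := by
  obtain ⟨i, hi⟩ := exists_word_eq_monomial z hl
  exact StarAlgebra.subset_adjoin ℂ _ ⟨i, hi⟩

theorem IsHalfLiberated.commute_of_mem (h : IsHalfLiberated K z) {a b : B}
    (ha : a ∈ wordAlgebra K z) (hb : b ∈ wordAlgebra K z) : Commute a b := by
  have := StarAlgebra.isMulCommutative_adjoin ℂ
    (s := Set.range fun i : Fin K → Fin N => word z i)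
    (by rintro _ ⟨i, rfl⟩ _ ⟨j, rfl⟩; exact h.comm i j)
    (by
      rintro _ ⟨i, rfl⟩ _ ⟨j, rfl⟩
      simp only [word_eq_monomial]
      exact h.monomial_comm_star (by simp) (by simp))
  exact congrArg Subtype.val (mul_comm' (⟨a, ha⟩ : wordAlgebra K z) ⟨b, hb⟩)

/-- Inserting `∑ y y^* = 1` between the factors lengthens both monomials to length `K`. The next
lemma does the same with `∑ y^* y = 1`. -/
theorem IsHalfLiberated.monomial_mul_star_mem (h : IsHalfLiberated K z) {l l' : List (Fin N)}
    (hl : l.length ≤ K) (hl' : l'.length = l.length) :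
    monomial z l * star (monomial z l') ∈ wordAlgebra K z := by
  have key : monomial z l * star (monomial z l') =
      ∑ y : Fin (K - l.length) → Fin N,
        monomial z (l ++ List.ofFn y) * star (monomial z (l' ++ List.ofFn y)) := by
    simp only [monomial_append, star_mul, mul_assoc, ← Finset.mul_sum, ← word_eq_monomial,
      sum_word_mul_star_mul h.sum_mul_star]
  rw [key]
  exact sum_mem fun y _ => mul_mem (monomial_mem_wordAlgebra (by simp; omega))
    (star_mem (monomial_mem_wordAlgebra (by simp; omega)))

theorem IsHalfLiberated.star_mul_monomial_mem (h : IsHalfLiberated K z) {l l' : List (Fin N)}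
    (hl : l.length ≤ K) (hl' : l'.length = l.length) :
    star (monomial z l) * monomial z l' ∈ wordAlgebra K z := by
  have key : star (monomial z l) * monomial z l' =
      ∑ y : Fin (K - l.length) → Fin N,
        star (monomial z (List.ofFn y ++ l)) * monomial z (List.ofFn y ++ l') := by
    simp only [monomial_append, star_mul, mul_assoc, ← Finset.mul_sum, ← word_eq_monomial,
      sum_star_mul_word_mul h.sum_star_mul]
  rw [key]
  exact sum_mem fun y _ => mul_mem (star_mem (monomial_mem_wordAlgebra (by simp; omega)))
    (monomial_mem_wordAlgebra (by simp; omega))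

/-- Generators separated by `K - 1` further generators may be interchanged. -/
theorem IsHalfLiberated.swap (h : IsHalfLiberated K z) {l : List (Fin N)}
    (hl : l.length + 1 = K) (a b : Fin N) :
    z a * monomial z l * z b = z b * monomial z l * z a := by
  have key : z a * monomial z l * z b = ∑ y : Fin l.length → Fin N,
      z b * (monomial z l * (star (monomial z (List.ofFn y)) * monomial z (List.ofFn y))) *
        z a := by
    -- After `y y^*` is inserted on the right, `z_a l` commutes with `z_b y`, and then `y z_a`
    -- commutes with `l y^*`, which lies in the word algebra. What remains is `z_b l (y^* y) z_a`,
    -- and the `y^* y` sum to `1`.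
    calc z a * monomial z l * z b
        = ∑ y : Fin l.length → Fin N,
          z a * monomial z l * z b * (word z y * star (word z y)) := by
          rw [← Finset.mul_sum, sum_word_mul_star h.sum_mul_star, mul_one]
      _ = _ := Finset.sum_congr rfl fun y _ => by
        have h1 : Commute (monomial z (a :: l)) (monomial z (b :: List.ofFn y)) :=
          h.monomial_comm (by simpa) (by simpa)
        have h2 : Commute (monomial z (List.ofFn y ++ [a]))
            (monomial z l * star (monomial z (List.ofFn y))) :=
          h.commute_of_mem (monomial_mem_wordAlgebra (by simpa))
            (h.monomial_mul_star_mem (by omega) (by simp))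
        simp only [monomial_cons, monomial_append, monomial_nil, mul_one] at h1 h2
        rw [word_eq_monomial]
        calc z a * monomial z l * z b *
              (monomial z (List.ofFn y) * star (monomial z (List.ofFn y)))
            = (z a * monomial z l) * (z b * monomial z (List.ofFn y)) *
              star (monomial z (List.ofFn y)) := by simp only [mul_assoc]
          _ = z b * ((monomial z (List.ofFn y) * z a) *
              (monomial z l * star (monomial z (List.ofFn y)))) := by
            rw [h1.eq]; simp only [mul_assoc]
          _ = _ := by rw [h2.eq]; simp only [mul_assoc]
  rw [key, ← Finset.sum_mul, ← Finset.mul_sum, ← Finset.mul_sum]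
  simp only [← word_eq_monomial, sum_star_mul_word h.sum_star_mul, mul_one]

/-- The relations `r_i r_j = r_{i'} r_{j'}`, where `(i', j')` arises from `(i, j)` by
interchanging the entries at one position. -/
theorem IsHalfLiberated.word_mul_word (h : IsHalfLiberated K z) (i j : Fin K → Fin N)
    (k : Fin K) : word z i * word z j =
      word z (Function.update i k (j k)) * word z (Function.update j k (i k)) := by
  have hset : ∀ (i : Fin K → Fin N) (b : Fin N), List.ofFn (Function.update i k b) =
      (List.ofFn i).take k ++ b :: (List.ofFn i).drop (k + 1) := by
    intro i b
    have hlt : k < (List.ofFn i).length := by simp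
    have hs := List.set_eq_take_append_cons_drop (l := List.ofFn i) (i := k) (a := b)
    rw [if_pos hlt] at hs
    rw [← hs]
    refine List.ext_getElem (by simp) fun n h1 h2 => ?_
    simp only [List.getElem_ofFn, List.getElem_set, Function.update_apply, Fin.ext_iff,
      eq_comm (a := n)]
  have hi := hset i (i k)
  have hj := hset j (j k)
  rw [Function.update_eq_self] at hi hj
  simp only [word_eq_monomial]
  rw [hset, hset, congrArg (monomial z) hi, congrArg (monomial z) hj]
  -- In the concatenation of `i` and `j`, the two letters at position `k` are separated by `(K - k -
  -- 1) + k = K - 1` letters.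
  have hs := h.swap (l := (List.ofFn i).drop (k + 1) ++ (List.ofFn j).take k)
    (by simp; omega) (i k) (j k)
  simp only [monomial_append, monomial_cons] at hs ⊢
  simp only [← mul_assoc] at hs ⊢
  have hs' := congrArg (fun x => monomial z ((List.ofFn i).take k) * x *
    monomial z ((List.ofFn j).drop (k + 1))) hs
  simpa only [← mul_assoc] using hs'

/-! ### Normal form: monomials times the word algebra -/

/-- Generators move past the word algebra. -/
theorem IsHalfLiberated.exists_mul_coord (h : IsHalfLiberated K z) (hK : 1 ≤ K) {a : B}
    (ha : a ∈ wordAlgebra K z) (i : Fin N) :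
    ∃ c : Fin N → B, (∀ j, c j ∈ wordAlgebra K z) ∧ a * z i = ∑ j, z j * c j := by
  have hsingle : ∀ {j : Fin N} {x : B}, x ∈ wordAlgebra K z →
      ∃ c : Fin N → B, (∀ j, c j ∈ wordAlgebra K z) ∧ z j * x = ∑ j, z j * c j := by
    intro j x hx
    refine ⟨Pi.single j x, fun k => ?_, ?_⟩
    · by_cases hk : k = j
      · subst hk; simpa
      · simp [hk, zero_mem]
    · rw [Finset.sum_eq_single j] <;> simp +contextual
  rw [← StarSubalgebra.mem_toSubalgebra, StarAlgebra.adjoin_toSubalgebra] at ha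
  induction ha using Algebra.adjoin_induction generalizing i with
  | mem x hx =>
    rcases hx with ⟨w, rfl⟩ | ⟨w, hw⟩
    · have hw : (List.ofFn w).length = K := by simp
      simp only [word_eq_monomial]
      cases hl : List.ofFn w with
      | nil => rw [hl] at hw; simp at hw; omega
      | cons b t =>
        rw [hl] at hw
        have := hsingle (j := b) (monomial_mem_wordAlgebra (z := z) (l := t ++ [i])
          (by simpa using hw))
        simpa [mul_assoc] using this
    · have hx : x = star (word z w) := by exact (star_eq_iff_star_eq.1 hw.symm).symm
      have hw : (List.ofFn w).length = K := by simp
      rw [hx]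
      simp only [word_eq_monomial]
      cases hl : List.ofFn w with
      | nil => rw [hl] at hw; simp at hw; omega
      | cons b t =>
        rw [hl] at hw
        -- With `∑ z_j z_j^* = 1` inserted on the left, `(z_b t)^* z_i` becomes `∑ z_j (t z_j)^*
        -- (z_b^* z_i)`, where `t z_j` has length `K`.
        refine ⟨fun j => star (monomial z (t ++ [j])) * (star (monomial z [b]) * monomial z [i]),
          fun j => mul_mem (star_mem (monomial_mem_wordAlgebra (by simpa using hw)))
            (h.star_mul_monomial_mem (by simpa) (by simp)), ?_⟩
        simp only [monomial_append, monomial_cons, monomial_nil, mul_one, star_mul]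
        simp only [← mul_assoc, ← Finset.sum_mul, h.sum_mul_star, one_mul]
  | algebraMap r =>
    rw [Algebra.commutes]
    exact hsingle (algebraMap_mem _ r)
  | add x y _ _ hx hy =>
    obtain ⟨c, hc, hxc⟩ := hx i
    obtain ⟨d, hd, hyd⟩ := hy i
    exact ⟨c + d, fun j => add_mem (hc j) (hd j), by
      simp [add_mul, hxc, hyd, mul_add, Finset.sum_add_distrib]⟩
  | mul x y _ _ hx hy =>
    obtain ⟨d, hd, hyd⟩ := hy i
    choose c hc hxc using hx
    refine ⟨fun k => ∑ j, c j k * d j, fun k => sum_mem fun j _ => mul_mem (hc j k) (hd j), ?_⟩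
    rw [mul_assoc, hyd]
    simp only [Finset.mul_sum, ← mul_assoc, hxc, Finset.sum_mul]
    exact Finset.sum_comm

variable (K z) in
/-- The span of the products of a monomial with an element of the word algebra. -/
def monomialSpan : Submodule ℂ B :=
  Submodule.span ℂ {x | ∃ l : List (Fin N), ∃ a ∈ wordAlgebra K z, x = monomial z l * a}

theorem monomial_mul_mem_monomialSpan {a : B} (ha : a ∈ wordAlgebra K z) (l : List (Fin N)) :
    monomial z l * a ∈ monomialSpan K z :=
  Submodule.subset_span ⟨l, a, ha, rfl⟩

theorem mul_mem_monomialSpan {x a : B} (hx : x ∈ monomialSpan K z) (ha : a ∈ wordAlgebra K z) :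
    x * a ∈ monomialSpan K z := by
  induction hx using Submodule.span_induction with
  | mem x hx =>
    obtain ⟨l, b, hb, rfl⟩ := hx
    rw [mul_assoc]
    exact monomial_mul_mem_monomialSpan (mul_mem hb ha) l
  | zero => simp
  | add x y _ _ hx hy => rw [add_mul]; exact add_mem hx hy
  | smul c x _ hx => rw [smul_mul_assoc]; exact Submodule.smul_mem _ c hx

theorem IsHalfLiberated.mul_coord_mem (h : IsHalfLiberated K z) (hK : 1 ≤ K) {x : B}
    (hx : x ∈ monomialSpan K z) (i : Fin N) : x * z i ∈ monomialSpan K z := by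
  induction hx using Submodule.span_induction with
  | mem x hx =>
    obtain ⟨l, b, hb, rfl⟩ := hx
    obtain ⟨c, hc, hbc⟩ := h.exists_mul_coord hK hb i
    rw [mul_assoc, hbc, Finset.mul_sum]
    refine sum_mem fun j _ => ?_
    have := monomial_mul_mem_monomialSpan (hc j) (l ++ [j])
    simpa [mul_assoc] using this
  | zero => simp
  | add x y _ _ hx hy => rw [add_mul]; exact add_mem hx hy
  | smul c x _ hx => rw [smul_mul_assoc]; exact Submodule.smul_mem _ c hx

theorem IsHalfLiberated.mul_monomial_mem (h : IsHalfLiberated K z) (hK : 1 ≤ K) {x : B}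
    (hx : x ∈ monomialSpan K z) (l : List (Fin N)) : x * monomial z l ∈ monomialSpan K z := by
  induction l generalizing x with
  | nil => simpa
  | cons a l ih =>
    rw [monomial_cons, ← mul_assoc]
    exact ih (h.mul_coord_mem hK hx a)

/-- Since `z_i^* = ∑ y (z_i y)^*` over words `y` of length `K - 1`, an adjoint generator can be
traded for generators followed by adjoints of words of length `K`. -/
theorem IsHalfLiberated.mul_star_coord_mem (h : IsHalfLiberated K z) (hK : 1 ≤ K) {x : B}
    (hx : x ∈ monomialSpan K z) (i : Fin N) : x * star (z i) ∈ monomialSpan K z := by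
  have key : x * star (z i) = ∑ y : Fin (K - 1) → Fin N,
      x * monomial z (List.ofFn y) * star (monomial z (i :: List.ofFn y)) := by
    simp only [monomial_cons, star_mul, mul_assoc, ← Finset.mul_sum, ← word_eq_monomial,
      sum_word_mul_star_mul h.sum_mul_star]
  rw [key]
  exact sum_mem fun y _ => mul_mem_monomialSpan (h.mul_monomial_mem hK hx _)
    (star_mem (monomial_mem_wordAlgebra (by simp; omega)))

theorem IsHalfLiberated.adjoin_le_monomialSpan (h : IsHalfLiberated K z) (hK : 1 ≤ K) {x : B}
    (hx : x ∈ StarAlgebra.adjoin ℂ (Set.range z)) : x ∈ monomialSpan K z := by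
  -- Stability of the span under right multiplication is inherited by products, which membership in
  -- the span is not directly.
  suffices H : ∀ y ∈ monomialSpan K z, y * x ∈ monomialSpan K z by
    simpa using H 1 (by simpa using monomial_mul_mem_monomialSpan (K := K) (z := z) (one_mem _) [])
  rw [← StarSubalgebra.mem_toSubalgebra, StarAlgebra.adjoin_toSubalgebra] at hx
  induction hx using Algebra.adjoin_induction with
  | mem x hx =>
    intro y hy
    rcases hx with ⟨i, rfl⟩ | ⟨i, hi⟩
    · exact h.mul_coord_mem hK hy i
    · rw [show x = star (z i) by rw [hi, star_star]]
      exact h.mul_star_coord_mem hK hy i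
  | algebraMap r =>
    intro y hy
    rw [← Algebra.commutes, ← Algebra.smul_def]
    exact Submodule.smul_mem _ r hy
  | add a b _ _ ha hb => intro y hy; rw [mul_add]; exact add_mem (ha y hy) (hb y hy)
  | mul a b _ _ ha hb => intro y hy; rw [← mul_assoc]; exact hb _ (ha y hy)

end Monomials

/-! ### Generation of the degree zero component -/

section DegreeZero

variable {N K : ℕ}

theorem rotation_coord (ω : Circle) (n : Fin N) :
    rotation (K := K) ω (coord n) = (ω : ℂ) • coord n :=
  lift_coord _ _ n

theorem rotation_monomial (ω : Circle) (l : List (Fin N)) :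
    rotation (K := K) ω (monomial coord l) = (ω : ℂ) ^ l.length • monomial coord l := by
  induction l with
  | nil => simp
  | cons a l ih =>
    rw [monomial_cons, map_mul, ih, rotation_coord, smul_mul_smul_comm, List.length_cons, pow_succ']

theorem word_mem_degreeZero (i : Fin K → Fin N) : word coord i ∈ degreeZero N K :=
  mem_component_zero.2 fun ω hω => by
    rw [word_eq_monomial, rotation_monomial, List.length_ofFn, ← Circle.coe_pow, hω]
    simp

theorem wordAlgebra_le_degreeZero : wordAlgebra K (coord : Fin N → sphere N K) ≤ degreeZero N K :=
  StarAlgebra.adjoin_le (by rintro _ ⟨i, rfl⟩; exact word_mem_degreeZero i)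

theorem exists_isPrimitiveRoot_circle (hK : 1 ≤ K) : ∃ ζ : Circle, IsPrimitiveRoot (ζ : ℂ) K := by
  refine ⟨Circle.exp (2 * Real.pi / K), ?_⟩
  have h := Complex.isPrimitiveRoot_exp K (by omega)
  rw [Circle.coe_exp]
  convert h using 2
  push_cast
  ring

/-- The average of the rotations by the powers of `ζ`. -/
def average (ζ : Circle) : sphere N K →ₗ[ℂ] sphere N K where
  toFun x := (K : ℂ)⁻¹ • ∑ k ∈ Finset.range K, rotation (ζ ^ k) x
  map_add' x y := by simp only [map_add, Finset.sum_add_distrib, smul_add]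
  map_smul' c x := by
    simp only [map_smul, ← Finset.smul_sum, RingHom.id_apply]
    exact smul_comm _ _ _

theorem average_apply (ζ : Circle) (x : sphere N K) :
    average ζ x = (K : ℂ)⁻¹ • ∑ k ∈ Finset.range K, rotation (ζ ^ k) x := rfl

theorem continuous_average (ζ : Circle) : Continuous (average ζ : sphere N K → sphere N K) := by
  have h (k : ℕ) : Continuous (rotation (ζ ^ k) : sphere N K →⋆ₐ[ℂ] sphere N K) := map_continuous _
  exact (continuous_finsetSum (Finset.range K) fun k _ => h k).const_smul (K : ℂ)⁻¹

theorem average_of_mem_degreeZero (hK : 1 ≤ K) {ζ : Circle} (hζ : ζ ^ K = 1) {x : sphere N K}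
    (hx : x ∈ degreeZero N K) : average ζ x = x := by
  have h : ∀ k, rotation (ζ ^ k) x = x := fun k =>
    mem_component_zero.1 hx _ (by rw [← pow_mul, mul_comm, pow_mul, hζ, one_pow])
  have hK' : (K : ℂ) ≠ 0 := by exact_mod_cast (by omega : K ≠ 0)
  rw [average_apply]
  simp only [h, Finset.sum_const, Finset.card_range]
  rw [← Nat.cast_smul_eq_nsmul ℂ, smul_smul, inv_mul_cancel₀ hK', one_smul]

theorem monomial_mem_of_dvd {B : Type*} [Ring B] [StarRing B] [Algebra ℂ B] [StarModule ℂ B]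
    {z : Fin N → B} {l : List (Fin N)} (hl : K ∣ l.length) : monomial z l ∈ wordAlgebra K z := by
  obtain ⟨m, hm⟩ := hl
  induction m generalizing l with
  | zero => simp only [mul_zero, List.length_eq_zero_iff] at hm; subst hm; simp [one_mem]
  | succ m ih =>
    rw [← List.take_append_drop K l, monomial_append]
    rw [mul_add, mul_one] at hm
    exact mul_mem (monomial_mem_wordAlgebra (by simp; omega)) (ih (by simp; omega))

/-- Rotation by `ζ ^ k` fixes the factor from the word algebra and scales a monomial of length `m`
by `ζ ^ (k * m)`. The resulting geometric sum vanishes unless `K` divides `m`, in which case the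
monomial is a product of words. -/
theorem average_mem_wordAlgebra {ζ : Circle} (hζ : IsPrimitiveRoot (ζ : ℂ) K) {x : sphere N K}
    (hx : x ∈ monomialSpan K (coord : Fin N → sphere N K)) :
    average ζ x ∈ wordAlgebra K (coord : Fin N → sphere N K) := by
  have hζ1 : ζ ^ K = 1 := Circle.ext (by simpa using hζ.pow_eq_one)
  induction hx using Submodule.span_induction with
  | mem x hx =>
    obtain ⟨l, a, ha, rfl⟩ := hx
    have h : ∀ k, rotation (ζ ^ k) (monomial coord l * a) =
        ((ζ : ℂ) ^ l.length) ^ k • (monomial coord l * a) := fun k => by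
      rw [map_mul, rotation_monomial, mem_component_zero.1 (wordAlgebra_le_degreeZero ha) (ζ ^ k)
        (by rw [← pow_mul, mul_comm, pow_mul, hζ1, one_pow]), smul_mul_assoc, Circle.coe_pow,
        ← pow_mul, ← pow_mul, mul_comm k]
    rw [average_apply]
    simp only [h, ← Finset.sum_smul]
    by_cases h1 : (ζ : ℂ) ^ l.length = 1
    · exact SMulMemClass.smul_mem _ (SMulMemClass.smul_mem _
        (mul_mem (monomial_mem_of_dvd (hζ.pow_eq_one_iff_dvd _ |>.1 h1)) ha))
    · have h2 := geom_sum_mul ((ζ : ℂ) ^ l.length) K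
      rw [pow_right_comm, hζ.pow_eq_one, one_pow, sub_self] at h2
      rw [(mul_eq_zero.1 h2).resolve_right (sub_ne_zero.2 h1), zero_smul, smul_zero]
      exact zero_mem _
  | zero => simp
  | add x y _ _ hx hy => rw [map_add]; exact add_mem hx hy
  | smul c x _ hx => rw [map_smul]; exact SMulMemClass.smul_mem _ hx

theorem mem_closure_adjoin_coord (x : sphere N K) :
    x ∈ closure (StarAlgebra.adjoin ℂ (Set.range (coord : Fin N → sphere N K)) :
      Set (sphere N K)) := by
  rw [closure_subtype]
  have h : (Subtype.val '' (StarAlgebra.adjoin ℂ (Set.range (coord : Fin N → sphere N K)) :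
      Set (sphere N K))) =
      (StarAlgebra.adjoin ℂ (Set.range (ambientCoord : Fin N → Ambient N K)) :
        Set (Ambient N K)) := by
    have := StarAlgHom.map_adjoin (sphere N K).subtype
      (Set.range (coord : Fin N → sphere N K))
    rw [← Set.range_comp] at this
    exact congrArg (fun S : StarSubalgebra ℂ (Ambient N K) => (S : Set (Ambient N K))) this
  rw [h]
  exact x.2

/-- The degree zero component is the `C^*`-algebra generated by the words of length `K`. -/
theorem degreeZero_subset_closure (hK : 1 ≤ K) : (degreeZero N K : Set (sphere N K)) ⊆
    closure (wordAlgebra K (coord : Fin N → sphere N K) : Set (sphere N K)) := by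
  obtain ⟨ζ, hζ⟩ := exists_isPrimitiveRoot_circle hK
  intro x hx
  rw [← average_of_mem_degreeZero hK (Circle.ext (by simpa using hζ.pow_eq_one)) hx]
  exact map_mem_closure (continuous_average ζ) (mem_closure_adjoin_coord x) fun y hy =>
    average_mem_wordAlgebra hζ ((coord_rel N K).adjoin_le_monomialSpan hK hy)

/-- Commutation is a closed condition, so it passes from the word algebra to its closure one
variable at a time. -/
theorem degreeZero_mul_comm (hK : 1 ≤ K) (a b : degreeZero N K) : a * b = b * a := by
  have h : ∀ x ∈ wordAlgebra K (coord : Fin N → sphere N K), ∀ y ∈ degreeZero N K,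
      Commute x y := fun x hx y hy =>
    (isClosed_eq (continuous_const.mul continuous_id) (continuous_id.mul continuous_const)
      ).closure_subset_iff.2 (fun y hy => (coord_rel N K).commute_of_mem hx hy)
      (degreeZero_subset_closure hK hy)
  have h' : Commute (a : sphere N K) b :=
    (isClosed_eq (continuous_id.mul continuous_const) (continuous_const.mul continuous_id)
      ).closure_subset_iff.2 (fun x hx => h x hx b b.2) (degreeZero_subset_closure hK a.2)
  exact Subtype.ext h'

/-- The word `z_{i_1} ⋯ z_{i_K}` as an element of the degree zero component. -/
def degreeZeroWord (i : Fin K → Fin N) : degreeZero N K := ⟨word coord i, word_mem_degreeZero i⟩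

/-- `*`-homomorphisms out of the degree zero component are determined by their values on words. -/
theorem degreeZero_hom_ext (hK : 1 ≤ K) {B : Type*} [CStarAlgebra B]
    {f g : degreeZero N K →⋆ₐ[ℂ] B} (h : ∀ i, f (degreeZeroWord i) = g (degreeZeroWord i)) :
    f = g := by
  have hS : StarAlgebra.adjoin ℂ (Set.range (degreeZeroWord : _ → degreeZero N K)) ≤
      StarAlgHom.equalizer f g :=
    StarAlgHom.adjoin_le_equalizer f g (by rintro _ ⟨i, rfl⟩; exact h i)
  refine StarAlgHom.ext fun x => ?_
  have himage : (Subtype.val '' (StarAlgebra.adjoin ℂ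
      (Set.range (degreeZeroWord : _ → degreeZero N K)) : Set (degreeZero N K))) =
      (wordAlgebra K (coord : Fin N → sphere N K) : Set (sphere N K)) := by
    have := StarAlgHom.map_adjoin (degreeZero N K).subtype
      (Set.range (degreeZeroWord : _ → degreeZero N K))
    rw [← Set.range_comp] at this
    exact congrArg (fun S : StarSubalgebra ℂ (sphere N K) => (S : Set (sphere N K))) this
  have hx : x ∈ closure (StarAlgebra.adjoin ℂ
      (Set.range (degreeZeroWord : _ → degreeZero N K)) : Set (degreeZero N K)) := by
    rw [closure_subtype, himage]
    exact degreeZero_subset_closure hK x.2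
  exact (isClosed_eq (map_continuous f) (map_continuous g)).closure_subset_iff.2
    (fun y hy => hS hy) hx

end DegreeZero

/-! ### Tensors of rank one -/

section Rank

variable {N K : ℕ}

/-- Each swap against `j` moves one letter of `i` into a copy of `j`, at the cost of one factor `r
j`. With all positions swapped, `r` factors through its slices along the coordinate lines through
`j`. -/
theorem mul_pow_eq_of_swap {r : (Fin K → Fin N) → ℂ}
    (h : ∀ i j k, r i * r j = r (Function.update i k (j k)) * r (Function.update j k (i k)))
    (i j : Fin K → Fin N) (s : Finset (Fin K)) :
    r (s.piecewise i j) * r j ^ s.card = r j * ∏ k ∈ s, r (Function.update j k (i k)) := by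
  induction s using Finset.induction with
  | empty => simp
  | insert k s hk ih =>
    have h1 := h ((insert k s).piecewise i j) j k
    have h2 : Function.update ((insert k s).piecewise i j) k (j k) = s.piecewise i j := by
      ext t
      by_cases ht : t = k
      · subst ht; simp [hk]
      · simp [ht, Finset.piecewise, Finset.mem_insert]
    rw [h2, Finset.piecewise_eq_of_mem _ _ _ (Finset.mem_insert_self k s)] at h1
    rw [Finset.card_insert_of_notMem hk, Finset.prod_insert hk, pow_succ']
    linear_combination r j ^ s.card * h1 + r (Function.update j k (i k)) * ih

/-- A unit vector satisfying the quadratic relations is a pure tensor. -/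
theorem mem_pureUnit_of_swap (hK : 1 ≤ K) {r : EuclideanSpace ℂ (Fin K → Fin N)}
    (hr : ‖r‖ = 1)
    (h : ∀ i j k, r i * r j = r (Function.update i k (j k)) * r (Function.update j k (i k))) :
    r ∈ pureUnit N K := by
  have hne : ∃ j, r j ≠ 0 := by
    by_contra! h0
    have : r = 0 := by ext j; exact h0 j
    simp [this] at hr
  obtain ⟨j, hj⟩ := hne
  -- The factorization reads `r_i = r_j ∏ (slice / r_j)`. The `K`-th root `c` spreads the leading
  -- `r_j` evenly over the `K` vectors.
  obtain ⟨c, hc⟩ := IsAlgClosed.exists_pow_nat_eq (r j) (n := K) (by omega)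
  have hc0 : c ≠ 0 := by
    rintro rfl
    rw [zero_pow (by omega)] at hc
    exact hj hc.symm
  refine ⟨hr, fun k => WithLp.toLp 2 fun a => c / r j * r (Function.update j k a), fun k hk => ?_,
    (tensorOf_eq_tprod_iff _ _).2 fun i => ?_⟩
  · have := congrArg (fun v : EuclideanSpace ℂ (Fin N) => v (j k)) hk
    simp [hc0, hj] at this
  · have hi := mul_pow_eq_of_swap h i j Finset.univ
    simp only [Finset.piecewise_univ, Finset.card_univ, Fintype.card_fin] at hi
    simp only [Finset.prod_mul_distrib, Finset.prod_const, Finset.card_univ, Fintype.card_fin,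
      div_pow, hc]
    field_simp
    exact hi

/-- The values on words of a `*`-homomorphism to `ℂ` form a pure tensor of norm one. -/
theorem char_mem_pureUnit (hK : 1 ≤ K) (χ : degreeZero N K →⋆ₐ[ℂ] ℂ) :
    WithLp.toLp 2 (fun i => χ (degreeZeroWord i)) ∈ pureUnit N K := by
  refine mem_pureUnit_of_swap hK ?_ fun i j k => ?_
  · have h : ∑ i : Fin K → Fin N, degreeZeroWord i * star (degreeZeroWord i) = 1 :=
      Subtype.ext (by
        simpa [degreeZeroWord] using sum_word_mul_star (coord_rel N K).sum_mul_star K)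
    have h2 := congrArg χ h
    simp only [map_sum, map_mul, map_star, map_one, Complex.star_def, Complex.mul_conj,
      Complex.normSq_eq_norm_sq] at h2
    rw [EuclideanSpace.norm_eq, Real.sqrt_eq_one]
    exact_mod_cast h2
  · simp only [← map_mul]
    exact congrArg χ (Subtype.ext ((coord_rel N K).word_mul_word i j k))

end Rank

/-! ### Cyclic weighted shifts -/

section Shift

open scoped ComplexOrder

variable {N K : ℕ}

/-- The matrices `∑ k, v_k(n) E_{k,k+1}`. -/
def cyclicShift (v : ZMod K → EuclideanSpace ℂ (Fin N)) (n : Fin N) :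
    CStarMatrix (ZMod K) (ZMod K) ℂ :=
  CStarMatrix.ofMatrix fun k l => if l = k + 1 then v k n else 0

variable (v : ZMod K → EuclideanSpace ℂ (Fin N))

theorem cyclicShift_apply (n : Fin N) (k l : ZMod K) :
    cyclicShift v n k l = if l = k + 1 then v k n else 0 := rfl

variable [NeZero K]

/-- Each letter moves one step around the cycle, so from `k` there is a single path of length `m`.
For `m = K` it closes up, which makes words of length `K` diagonal. -/
theorem word_cyclicShift_apply {m : ℕ} (i : Fin m → Fin N) (k l : ZMod K) :
    word (cyclicShift v) i k l = if l = k + m then ∏ t : Fin m, v (k + (t : ℕ)) (i t) else 0 := by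
  induction m generalizing k with
  | zero => simp [word, CStarMatrix.one_apply, eq_comm]
  | succ m ih =>
    have h : word (cyclicShift v) i =
        cyclicShift v (i 0) * word (cyclicShift v) (fun t => i t.succ) := by simp [word]
    rw [h, CStarMatrix.mul_apply, Finset.sum_eq_single (k + 1)]
    · rw [ih, cyclicShift_apply, if_pos rfl, Fin.prod_univ_succ]
      simp [add_assoc, add_comm (1 : ZMod K)]
    · intro b _ hb
      rw [cyclicShift_apply, if_neg hb, zero_mul]
    · simp

theorem word_cyclicShift_apply_self (i : Fin K → Fin N) (k l : ZMod K) :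
    word (cyclicShift v) i k l =
      if k = l then ∏ t : Fin K, v (k + (t : ℕ)) (i t) else 0 := by
  rw [word_cyclicShift_apply]
  simp [eq_comm]

theorem commute_of_diagonal {ι : Type*} [Fintype ι] {a b : CStarMatrix ι ι ℂ}
    (ha : ∀ k l, k ≠ l → a k l = 0) (hb : ∀ k l, k ≠ l → b k l = 0) : Commute a b := by
  classical
  refine CStarMatrix.ext fun k l => ?_
  rw [CStarMatrix.mul_apply, CStarMatrix.mul_apply,
    Finset.sum_eq_single k (fun j _ hj => by rw [ha _ _ hj.symm, zero_mul]) (by simp),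
    Finset.sum_eq_single k (fun j _ hj => by rw [hb _ _ hj.symm, zero_mul]) (by simp)]
  by_cases h : k = l
  · subst h; exact mul_comm _ _
  · rw [ha _ _ h, hb _ _ h, mul_zero, mul_zero]

theorem cyclicShift_isHalfLiberated (hv : ∀ k, ‖v k‖ = 1) :
    IsHalfLiberated K (cyclicShift v) := by
  have hsum : ∀ k, ∑ n, v k n * star (v k n) = 1 := fun k => by
    have h := EuclideanSpace.norm_sq_eq (v k)
    rw [hv k, one_pow] at h
    simp only [Complex.star_def, Complex.mul_conj, Complex.normSq_eq_norm_sq]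
    exact_mod_cast h.symm
  have hdiag : ∀ (i : Fin K → Fin N) (k l : ZMod K), k ≠ l → word (cyclicShift v) i k l = 0 :=
    fun i k l h => by rw [word_cyclicShift_apply_self, if_neg h]
  have hsumapp : ∀ (f : Fin N → CStarMatrix (ZMod K) (ZMod K) ℂ) k l,
      (∑ n, f n) k l = ∑ n, f n k l := fun f k l => Matrix.sum_apply k l Finset.univ f
  refine ⟨CStarMatrix.ext fun k l => ?_, CStarMatrix.ext fun k l => ?_,
    fun i j => commute_of_diagonal (hdiag i) (hdiag j), fun i j => ?_⟩
  · rw [hsumapp, CStarMatrix.one_apply]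
    have h : ∀ n, (cyclicShift v n * star (cyclicShift v n)) k l =
        if k = l then v k n * star (v k n) else 0 := fun n => by
      rw [CStarMatrix.mul_apply, Finset.sum_eq_single (k + 1)]
      · simp only [CStarMatrix.star_apply, cyclicShift_apply, if_true, add_left_inj]
        split_ifs with h
        · rw [h]
        · simp
      · intro b _ hb
        rw [cyclicShift_apply, if_neg hb, zero_mul]
      · simp
    simp only [h]
    split_ifs with h
    · exact hsum k
    · simp
  · rw [hsumapp, CStarMatrix.one_apply]
    have h : ∀ n, (star (cyclicShift v n) * cyclicShift v n) k l =
        if k = l then v (k - 1) n * star (v (k - 1) n) else 0 := fun n => by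
      rw [CStarMatrix.mul_apply, Finset.sum_eq_single (k - 1)]
      · simp only [CStarMatrix.star_apply, cyclicShift_apply, sub_add_cancel, if_true,
          eq_comm (a := l)]
        split_ifs with h
        · rw [mul_comm]
        · simp
      · intro b _ hb
        rw [CStarMatrix.star_apply, cyclicShift_apply,
          if_neg (fun h => hb (eq_sub_of_add_eq h.symm)), star_zero, zero_mul]
      · simp
    simp only [h]
    split_ifs with h
    · exact hsum (k - 1)
    · simp
  · obtain ⟨j', hj'⟩ := exists_word_eq_monomial (cyclicShift v)
      (l := (List.ofFn j).reverse) (K := K) (by simp)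
    have h : word (fun n => star (cyclicShift v n)) j = star (word (cyclicShift v) j') := by
      rw [hj', star_monomial, List.reverse_reverse, word_eq_monomial]
    rw [h]
    refine commute_of_diagonal (hdiag i) fun k l hkl => ?_
    rw [CStarMatrix.star_apply, hdiag _ _ _ hkl.symm, star_zero]

/-- The representation by cyclic weighted shifts is diagonal on the degree zero component. -/
theorem lift_cyclicShift_apply_of_ne (hK : 1 ≤ K) (hv : ∀ k, ‖v k‖ = 1) (x : degreeZero N K)
    {l : ZMod K} (hl : l ≠ 0) :
    lift (cyclicShift v) (cyclicShift_isHalfLiberated v hv) (x : sphere N K) 0 l = 0 := by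
  set π := lift (cyclicShift v) (cyclicShift_isHalfLiberated v hv)
  -- The projection `E_{00}` commutes with the diagonal images of words, hence by continuity with
  -- the image of the degree zero component. Comparing the `(0, l)` entries of `p * π x` and `π x *
  -- p` gives the claim.
  let p : CStarMatrix (ZMod K) (ZMod K) ℂ :=
    CStarMatrix.ofMatrix fun k l => if k = 0 ∧ l = 0 then 1 else 0
  have hp : ∀ k l, p k l = if k = 0 ∧ l = 0 then 1 else 0 := fun _ _ => rfl
  have hpdiag : ∀ k l, k ≠ l → p k l = 0 := fun k l hkl => by
    rw [hp, if_neg]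
    rintro ⟨rfl, rfl⟩
    exact hkl rfl
  have hπw : ∀ i : Fin K → Fin N, π (word coord i) = word (cyclicShift v) i := fun i => by
    rw [map_word, funext (lift_coord (cyclicShift v) _)]
  have hle : wordAlgebra K (coord : Fin N → sphere N K) ≤
      (StarSubalgebra.centralizer ℂ {p}).comap π := by
    refine StarAlgebra.adjoin_le ?_
    rintro _ ⟨i, rfl⟩
    have hd : ∀ k l, k ≠ l → π (word coord i) k l = 0 := fun k l h => by
      rw [hπw, word_cyclicShift_apply_self, if_neg h]
    refine (StarSubalgebra.mem_centralizer_iff ℂ).2 ?_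
    rintro _ rfl
    refine ⟨commute_of_diagonal hpdiag hd, commute_of_diagonal ?_ hd⟩
    intro k l h
    rw [CStarMatrix.star_apply, hpdiag _ _ h.symm, star_zero]
  have hcont : Continuous π := map_continuous π
  have hcomm : p * π x = π x * p :=
    (isClosed_eq (continuous_const.mul hcont) (hcont.mul continuous_const)
      ).closure_subset_iff.2 (fun y hy =>
        ((StarSubalgebra.mem_centralizer_iff ℂ).1 (hle hy) p rfl).1)
      (degreeZero_subset_closure hK x.2)
  have h := congrArg (fun M : CStarMatrix (ZMod K) (ZMod K) ℂ => M 0 l) hcomm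
  simp only [CStarMatrix.mul_apply, hp, hl, and_false, if_false, mul_zero,
    Finset.sum_const_zero, true_and, ite_mul, one_mul, zero_mul, Finset.sum_ite_eq',
    Finset.mem_univ, if_true] at h
  exact h

/-- Every pure tensor of norm one comes from a character of the degree zero component. -/
theorem exists_char_of_mem_pureUnit (hK : 1 ≤ K) {r : EuclideanSpace ℂ (Fin K → Fin N)}
    (hr : r ∈ pureUnit N K) :
    ∃ χ : degreeZero N K →ₐ[ℂ] ℂ, ∀ i, χ (degreeZeroWord i) = r i := by
  rw [pureUnit_eq_image] at hr
  obtain ⟨u, hu, rfl⟩ := hr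
  let v : ZMod K → EuclideanSpace ℂ (Fin N) := fun k => u ⟨k.val, ZMod.val_lt k⟩
  have hv : ∀ k, ‖v k‖ = 1 := fun k => mem_sphere_zero_iff_norm.1 (hu _ trivial)
  let π := lift (cyclicShift v) (cyclicShift_isHalfLiberated v hv)
  -- The entries `(0, l)` with `l ≠ 0` vanish, so only one term of the matrix product contributes to
  -- the `(0, 0)` entry.
  have hmul : ∀ x y : degreeZero N K,
      π ((x * y : degreeZero N K) : sphere N K) 0 0 = π x 0 0 * π y 0 0 := fun x y => by
    change π ((x : sphere N K) * y) 0 0 = _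
    rw [map_mul, CStarMatrix.mul_apply, Finset.sum_eq_single 0]
    · intro l _ hl
      rw [lift_cyclicShift_apply_of_ne v hK hv x hl, zero_mul]
    · simp
  refine ⟨AlgHom.ofLinearMap
    { toFun := fun x => π (x : sphere N K) 0 0
      map_add' := fun x y => ?_
      map_smul' := fun c x => ?_ } ?_ hmul, fun i => ?_⟩
  · change π ((x : sphere N K) + y) 0 0 = _
    rw [map_add]
    rfl
  · change π (c • (x : sphere N K)) 0 0 = _
    rw [map_smul]
    rfl
  · change π 1 0 0 = 1
    rw [map_one, CStarMatrix.one_apply, if_pos rfl]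
  · change π (word coord i) 0 0 = _
    rw [map_word, funext (lift_coord (cyclicShift v) _), word_cyclicShift_apply_self, if_pos rfl]
    refine Finset.prod_congr rfl fun t _ => ?_
    simp [v, ZMod.val_natCast, Nat.mod_eq_of_lt t.2]

end Shift

/-! ### Gelfand duality for the degree zero component -/

/-- If the characters of a commutative unital `C^*`-algebra `D` are parametrized by a set `S` of
vectors through their values on a finite family `w`, then `D ≃ C(S)`. -/
theorem exists_starAlgEquiv_of_characters {D ι : Type*} [CommCStarAlgebra D] [Fintype ι]
    (w : ι → D) (S : Set (EuclideanSpace ℂ ι))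
    (hmem : ∀ χ : D →⋆ₐ[ℂ] ℂ, WithLp.toLp 2 (fun i => χ (w i)) ∈ S)
    (hinj : ∀ χ χ' : D →⋆ₐ[ℂ] ℂ, (∀ i, χ (w i) = χ' (w i)) → χ = χ')
    (hsurj : ∀ r ∈ S, ∃ χ : D →ₐ[ℂ] ℂ, ∀ i, χ (w i) = r i) :
    ∃ e : C(S, ℂ) ≃⋆ₐ[ℂ] D, ∀ (i : ι) (f : C(S, ℂ)),
      (∀ r : S, f r = (r : EuclideanSpace ℂ ι) i) → e f = w i := by
  open WeakDual in
  let toHom : characterSpace ℂ D → (D →⋆ₐ[ℂ] ℂ) := fun χ =>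
    -- Characters of a `C^*`-algebra preserve the star automatically.
    { CharacterSpace.equivAlgHom χ with map_star' := fun a => map_star χ a }
  let F : WeakDual.characterSpace ℂ D → S := fun χ => ⟨_, hmem (toHom χ)⟩
  have hbij : Function.Bijective F := by
    refine ⟨fun χ χ' h => ?_, fun r => ?_⟩
    · have := hinj (toHom χ) (toHom χ') fun i =>
        congrArg (fun r : S => (r : EuclideanSpace ℂ ι) i) h
      exact Subtype.ext (ContinuousLinearMap.ext fun a => DFunLike.congr_fun this a)
    · obtain ⟨χ, hχ⟩ := hsurj r r.2
      refine ⟨WeakDual.CharacterSpace.equivAlgHom.symm χ, Subtype.ext ?_⟩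
      ext i
      exact hχ i
  have hcont : Continuous F := by
    refine Continuous.subtype_mk ?_ _
    refine (PiLp.continuous_toLp 2 _).comp (continuous_pi fun i => ?_)
    exact (gelfandTransform ℂ D (w i)).continuous
  -- A continuous bijection from a compact space to a Hausdorff space is a homeomorphism.
  let h : WeakDual.characterSpace ℂ D ≃ₜ S :=
    Continuous.homeoOfEquivCompactToT2 (f := Equiv.ofBijective F hbij) hcont
  refine ⟨(h.compStarAlgEquiv' ℂ ℂ).trans (gelfandStarTransform D).symm, fun i f hf => ?_⟩
  have key : h.compStarAlgEquiv' ℂ ℂ f = gelfandStarTransform D (w i) :=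
    ContinuousMap.ext fun χ => hf (F χ)
  exact (congrArg _ key).trans ((gelfandStarTransform D).symm_apply_apply _)

end HalfLiberated

end

open HalfLiberated in
theorem corollary5p6 (N K : ℕ) (hK : 1 ≤ K) :
    ∃ Φ : C(pureUnit N K, ℂ) ≃⋆ₐ[ℂ] degreeZero N K,
      (∀ i : Fin K → Fin N, ((Φ (coordFun i) : degreeZero N K) : sphere N K) = word coord i) ∧
      ∀ Ψ : C(pureUnit N K, ℂ) →⋆ₐ[ℂ] degreeZero N K,
        (∀ i : Fin K → Fin N, ((Ψ (coordFun i) : degreeZero N K) : sphere N K) = word coord i) →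
          ∀ f, Ψ f = Φ f := by
  have : NeZero K := ⟨by omega⟩
  let inst : CommCStarAlgebra (degreeZero N K) :=
    { (inferInstance : CStarAlgebra (degreeZero N K)) with
      mul_comm := degreeZero_mul_comm hK }
  obtain ⟨Φ, hΦ⟩ := exists_starAlgEquiv_of_characters (D := degreeZero N K) degreeZeroWord
    (pureUnit N K) (char_mem_pureUnit hK) (fun χ χ' h => degreeZero_hom_ext hK h)
    (fun r hr => exists_char_of_mem_pureUnit hK hr)
  have hΦw : ∀ i, Φ (coordFun i) = degreeZeroWord i := fun i => hΦ i _ fun _ => rfl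
  refine ⟨Φ, fun i => congrArg Subtype.val (hΦw i), fun Ψ hΨ f => ?_⟩
  -- Uniqueness is tested on the degree zero side, where the words are already known to generate, so
  -- no density argument in `C(pureUnit N K, ℂ)` is needed.
  have hcomp : Ψ.comp (Φ.symm : degreeZero N K →⋆ₐ[ℂ] C(pureUnit N K, ℂ)) =
      StarAlgHom.id ℂ (degreeZero N K) := by
    refine degreeZero_hom_ext hK fun i => ?_
    rw [← hΦw i]
    refine (congrArg Ψ (Φ.symm_apply_apply _)).trans (Subtype.ext ?_)
    exact (hΨ i).trans (congrArg Subtype.val (hΦw i)).symm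
  have h := DFunLike.congr_fun hcomp (Φ f)
  exact (congrArg Ψ (Φ.symm_apply_apply f)).symm.trans h
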